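/- All logarithms are to base $2$; $H(\mathbf p)=-\sum_{i=1}^n p_i\log p_i$ is the Shannon entropy of a probability distribution $\mathbf p$ on $[n]$, and $h(\epsilon)=-(1-\epsilon)\log(1-\epsilon)-\epsilon\log\epsilon$ is the binary entropy (with $0\log 0=0$). A quantum query algorithm has access to a unitary oracle $U$; each query is one use of $U$ or $U^\dagger$, possibly controlled by the workspace, queries are interleaved with arbitrary unitaries that do not depend on $U$, on a workspace of any finite dimension, and the output is a real number computed from a final measurement. We consider four input models for $\mathbf p$: (i) frequency vector of length $m$: $U|j\rangle|b\rangle=|j\rangle|b+v_j \bmod n\rangle$ for a string $v\in[n]^m$ with $p_i=|\{j: v_j=i\}|/m$; (ii) list of $m$ samples: the same oracle for a string $v\in[n]^m$ whose entries are drawn independently from $\mathbf p$; (iii) quantum samples: any unitary $U$ on $\mathbb C^n$ with $U|0\rangle=\sum_i\sqrt{p_i}\,|i\rangle$; (iv) purified access: any unitary $U$ on $\mathbb C^n\otimes\mathbb C^n$ with $U|0\rangle|0\rangle=\sum_i\sqrt{p_i}\,|\psi_i\rangle|i\rangle$ for some orthonormal $|\psi_1\rangle,\dots,|\psi_n\rangle$.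 For $\gamma>1$, say that an algorithm $\gamma$-estimates the entropy with success probability $s$ in one of these models if, for every $\mathbf p$ on $[n]$ that the model can represent and that satisfies $H(\mathbf p)>0$ and $H(\mathbf p)\ge h\bigl(\min\{1,\gamma^2/\log n\}\bigr)$, and for every oracle for $\mathbf p$ in that model (in model (ii): on average over the samples), the probability that its output $\tilde H$ satisfies $H(\mathbf p)/\gamma\le\tilde H\le\gamma H(\mathbf p)$ is at least $s$. **Theorem.** For every $s>1/2$ there is a constant $c>0$, depending only on $s$, such that for all $n\ge 2$ (for $n=1$ the bound is trivially $0$) and all $\gamma>1$, every algorithm that $\gamma$-estimates the entropy with success probability $s$ makes at least $c\,\sqrt{\log n}/\gamma$ queries, in each of the models (i)–(iv): in model (i) for every $m\ge m_0(n,\gamma)$, and in model (ii) for every $m$. In particular, in each of these models $\gamma$-multiplicative estimation of the Shannon entropy requires $\Omega(\sqrt{\log n}/\gamma)$ queries. -/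

import Mathlib

noncomputable section

/-- Shannon entropy, in bits, of `p = (p₁, …, pₙ)` (with `0 log 0 = 0`). -/
def shannonEntropy {n : ℕ} (p : Fin n → ℝ) : ℝ :=
  -∑ i, p i * Real.logb 2 (p i)

/-- What a query does in one branch of the workspace: nothing, apply the oracle `U`, or apply its
adjoint `U†`. -/
inductive QueryMode
  | idle
  | forward
  | adjoint

/-- The operator that a query in the given mode applies to the oracle register. -/
def QueryMode.toMatrix {Q : Type} [Fintype Q] [DecidableEq Q] (U : Matrix Q Q ℂ) :
    QueryMode → Matrix Q Q ℂ
  | idle => 1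
  | forward => U
  | adjoint => U.conjTranspose

/-- A quantum query algorithm with real-valued output, for oracles `U` acting on the register `ℂ^Q`.
It has a workspace register of any finite dimension `dim`, starts in a computational basis state,
alternates oracle-independent unitaries on both registers with `queries` queries, measures all of
its registers in the computational basis, and outputs a real number computed from the outcome.
Query number `t` applies `U`, `U†` or the identity to the oracle register according to the content
`w` of the workspace. Constant modes are plain uses of `U` and of `U†`; modes that are `idle` on
part of the workspace are controlled uses. Entries of `unitary` and `mode` past the last query are
never used. -/
structure QueryAlgorithm (Q : Type) [Fintype Q] [DecidableEq Q] where
  queries : ℕ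
  dim : ℕ
  start : Q × Fin dim
  unitary : ℕ → Matrix.unitaryGroup (Q × Fin dim) ℂ
  mode : ℕ → Fin dim → QueryMode
  output : Q × Fin dim → ℝ

namespace QueryAlgorithm

variable {Q : Type} [Fintype Q] [DecidableEq Q]

/-- Query number `t` as an operator on the oracle register and the workspace. -/
def queryMatrix (A : QueryAlgorithm Q) (U : Matrix Q Q ℂ) (t : ℕ) :
    Matrix (Q × Fin A.dim) (Q × Fin A.dim) ℂ :=
  Matrix.blockDiagonal fun w => (A.mode t w).toMatrix U

/-- The state of the algorithm, run with oracle `U`, after `t` queries (and the unitary that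
follows the last one of them). -/
def state (A : QueryAlgorithm Q) (U : Matrix Q Q ℂ) : ℕ → (Q × Fin A.dim → ℂ)
  | 0 => (A.unitary 0 : Matrix (Q × Fin A.dim) (Q × Fin A.dim) ℂ).mulVec (Pi.single A.start 1)
  | t + 1 => (A.unitary (t + 1) : Matrix (Q × Fin A.dim) (Q × Fin A.dim) ℂ).mulVec
      ((A.queryMatrix U t).mulVec (A.state U t))

open Classical in
/-- The probability that the algorithm, run with oracle `U`, outputs an estimate of `x` to within
the multiplicative factor `γ`, that is, a number in `[x / γ, γ x]`. -/
def estimateProb (A : QueryAlgorithm Q) (U : Matrix Q Q ℂ) (γ x : ℝ) : ℝ :=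
  ∑ z, if x / γ ≤ A.output z ∧ A.output z ≤ γ * x then ‖A.state U A.queries z‖ ^ 2 else 0

end QueryAlgorithm

/-- The standard oracle of a string `v ∈ [n]^m`: `|j⟩|b⟩ ↦ |j⟩|b + v_j mod n⟩`, so that
`|j⟩|0⟩ ↦ |j⟩|v_j⟩`. -/
def stringOracle {m n : ℕ} (v : Fin m → Fin n) : Matrix (Fin m × Fin n) (Fin m × Fin n) ℂ :=
  Matrix.of fun x y => if x.1 = y.1 ∧ x.2 = y.2 + v y.1 then 1 else 0

theorem stringOracle_mem_unitaryGroup {m n : ℕ} [NeZero n] (v : Fin m → Fin n) :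
    stringOracle v ∈ Matrix.unitaryGroup (Fin m × Fin n) ℂ := by
  rw [Matrix.mem_unitaryGroup_iff']
  ext ⟨j, b⟩ ⟨k, d⟩
  simp only [Matrix.mul_apply, Matrix.star_apply, stringOracle, Matrix.of_apply,
    Matrix.one_apply, Fintype.sum_prod_type, Prod.mk.injEq]
  rw [Finset.sum_eq_single j, Finset.sum_eq_single (b + v j)]
  · by_cases hjk : j = k
    · subst hjk
      simp
    · simp [hjk]
  · intro c _ hc
    simp [hc]
  · simp
  · intro l _ hl
    simp [hl]
  · simp

/-- The distribution that a frequency vector `v ∈ [n]^m` represents: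
`p_i = |{j : v_j = i}| / m`. -/
def frequency {m n : ℕ} (v : Fin m → Fin n) (i : Fin n) : ℝ :=
  ((Finset.univ.filter fun j => v j = i).card : ℝ) / m

/-- `U` prepares the quantum sample of `p`: `U|0⟩ = ∑ᵢ √pᵢ |i⟩`. -/
def PreparesQuantumSample {n : ℕ} [NeZero n] (p : Fin n → ℝ) (U : Matrix (Fin n) (Fin n) ℂ) :
    Prop :=
  U.mulVec (Pi.single 0 1) = fun i => (√(p i) : ℂ)

/-- `U` prepares a purification of `p`: `U|0⟩|0⟩ = ∑ᵢ √pᵢ |ψᵢ⟩|i⟩` for some orthonormal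
`ψ₁, …, ψₙ`. -/
def PreparesPurification {n : ℕ} [NeZero n] (p : Fin n → ℝ)
    (U : Matrix (Fin n × Fin n) (Fin n × Fin n) ℂ) : Prop :=
  ∃ ψ : Fin n → EuclideanSpace ℂ (Fin n), Orthonormal ℂ ψ ∧
    U.mulVec (Pi.single (0, 0) 1) = fun x => (√(p x.2) : ℂ) * ψ x.2 x.1

/-- The inputs on which an algorithm has to be correct: `H(p) > 0` and `H(p) ≥ h(ε)`, where
`ε = min(1, γ² / log n)` and `h(ε)` is the entropy of `(1 - ε, ε)`. -/
def Promise {n : ℕ} (γ : ℝ) (p : Fin n → ℝ) : Prop :=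
  0 < shannonEntropy p ∧
    shannonEntropy ![1 - min 1 (γ ^ 2 / Real.logb 2 n), min 1 (γ ^ 2 / Real.logb 2 n)]
      ≤ shannonEntropy p

/-- `A` estimates the entropy to within the factor `γ`, with probability at least `s`, given query
access to frequency vectors of length `m`. -/
def EstimatesFromFrequencyVector {m n : ℕ} (A : QueryAlgorithm (Fin m × Fin n)) (γ s : ℝ) :
    Prop :=
  ∀ v : Fin m → Fin n, Promise γ (frequency v) →
    s ≤ A.estimateProb (stringOracle v) γ (shannonEntropy (frequency v))

/-- `A` estimates the entropy to within the factor `γ`, given query access to a list of `m`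
independent samples from `p`; the success probability is over both the samples and the
measurement. -/
def EstimatesFromSampleList {m n : ℕ} (A : QueryAlgorithm (Fin m × Fin n)) (γ s : ℝ) : Prop :=
  ∀ p ∈ stdSimplex ℝ (Fin n), Promise γ p →
    s ≤ ∑ v : Fin m → Fin n,
      (∏ j, p (v j)) * A.estimateProb (stringOracle v) γ (shannonEntropy p)

/-- `A` estimates the entropy to within the factor `γ`, given any unitary that prepares the quantum
sample of `p`. -/
def EstimatesFromQuantumSamples {n : ℕ} [NeZero n] (A : QueryAlgorithm (Fin n)) (γ s : ℝ) :
    Prop :=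
  ∀ p ∈ stdSimplex ℝ (Fin n), Promise γ p →
    ∀ U ∈ Matrix.unitaryGroup (Fin n) ℂ, PreparesQuantumSample p U →
      s ≤ A.estimateProb U γ (shannonEntropy p)

/-- `A` estimates the entropy to within the factor `γ`, given any unitary that prepares a
purification of `p`. -/
def EstimatesFromPurification {n : ℕ} [NeZero n] (A : QueryAlgorithm (Fin n × Fin n)) (γ s : ℝ) :
    Prop :=
  ∀ p ∈ stdSimplex ℝ (Fin n), Promise γ p →
    ∀ U ∈ Matrix.unitaryGroup (Fin n × Fin n) ℂ, PreparesPurification p U →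
      s ≤ A.estimateProb U γ (shannonEntropy p)

end

/-! The proof is a hybrid argument in which the reference oracle is the identity. There are two
distributions, both satisfying the promise, whose entropies differ by more than a factor `γ ^ 2`
although each puts all but `O(γ ^ 2 / log n)` of its mass on the letter 0 (`exists_hard_pair`):
moving a mass `δ` from one letter to all nonzero letters raises the entropy from at most 1 to at
least `δ log n`.

In every model such a distribution has an oracle, possibly random, that differs from the identity by
at most `√D` in quadratic mean on each fixed state, with `D = O(γ ^ 2 / log n)` (`NearIdentity`).
For strings, adding the letter 0 does nothing and each entry is rarely nonzero; for state
preparation, a rotation by a small angle suffices.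

Hence `T` queries move the final state by at most `T √D` on average
(`NearIdentity.sum_estimateProb_le`). With the identity as oracle, the two sets of acceptable
outputs are disjoint, so their probabilities sum to at most 1. Together, `2 s ≤ 1 + 4 T √D`
(`two_mul_le_of_nearIdentity`), which is the bound. -/

open Finset

/-! ### Euclidean norms of amplitude vectors and measurement probabilities. -/

/-- The Euclidean norm of a vector of amplitudes. -/
noncomputable def amplitudeNorm {ι : Type*} [Fintype ι] (f : ι → ℂ) : ℝ :=
  ‖(WithLp.toLp 2 f : EuclideanSpace ℂ ι)‖

section amplitudeNorm

variable {ι : Type*} [Fintype ι]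

theorem amplitudeNorm_sq (f : ι → ℂ) : amplitudeNorm f ^ 2 = ∑ z, ‖f z‖ ^ 2 := by
  simp [amplitudeNorm, EuclideanSpace.norm_sq_eq]

theorem amplitudeNorm_nonneg (f : ι → ℂ) : 0 ≤ amplitudeNorm f := norm_nonneg _

theorem amplitudeNorm_add_le (f g : ι → ℂ) :
    amplitudeNorm (f + g) ≤ amplitudeNorm f + amplitudeNorm g := by
  simpa [amplitudeNorm] using
    norm_add_le (WithLp.toLp 2 f : EuclideanSpace ℂ ι) (WithLp.toLp 2 g)

theorem amplitudeNorm_neg (f : ι → ℂ) : amplitudeNorm (-f) = amplitudeNorm f := by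
  simp [amplitudeNorm]

theorem amplitudeNorm_smul (a : ℂ) (f : ι → ℂ) :
    amplitudeNorm (a • f) = ‖a‖ * amplitudeNorm f := by
  simp [amplitudeNorm, norm_smul]

theorem norm_apply_le_amplitudeNorm (f : ι → ℂ) (z : ι) : ‖f z‖ ≤ amplitudeNorm f :=
  PiLp.norm_apply_le (WithLp.toLp 2 f : EuclideanSpace ℂ ι) z

theorem amplitudeNorm_single [DecidableEq ι] (z : ι) :
    amplitudeNorm (Pi.single z 1 : ι → ℂ) = 1 := by
  have h : amplitudeNorm (Pi.single z 1 : ι → ℂ) ^ 2 = 1 := by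
    rw [amplitudeNorm_sq, sum_eq_single z] <;> simp +contextual
  nlinarith [amplitudeNorm_nonneg (Pi.single z 1 : ι → ℂ)]

theorem norm_dotProduct_le (f g : ι → ℂ) :
    ‖f ⬝ᵥ g‖ ≤ amplitudeNorm f * amplitudeNorm g := by
  have h := norm_inner_le_norm (𝕜 := ℂ) (WithLp.toLp 2 (star f) : EuclideanSpace ℂ ι)
    (WithLp.toLp 2 g)
  have h1 : ‖(WithLp.toLp 2 (star f) : EuclideanSpace ℂ ι)‖ = amplitudeNorm f := by
    simp [amplitudeNorm, EuclideanSpace.norm_eq]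
  rw [h1] at h
  rwa [EuclideanSpace.inner_toLp_toLp, star_star, dotProduct_comm] at h

theorem amplitudeNorm_unitary_mulVec [DecidableEq ι] {U : Matrix ι ι ℂ}
    (hU : U ∈ Matrix.unitaryGroup ι ℂ) (f : ι → ℂ) :
    amplitudeNorm (U.mulVec f) = amplitudeNorm f := by
  have key : ∀ g : ι → ℂ, ((amplitudeNorm g ^ 2 : ℝ) : ℂ) = star g ⬝ᵥ g := by
    intro g
    rw [amplitudeNorm_sq]
    simp only [dotProduct, Pi.star_apply, RCLike.star_def, Complex.ofReal_sum]
    exact sum_congr rfl fun z _ => by rw [Complex.conj_mul']; simp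
  have h : ((amplitudeNorm (U.mulVec f) ^ 2 : ℝ) : ℂ) = ((amplitudeNorm f ^ 2 : ℝ) : ℂ) := by
    rw [key, key, Matrix.star_mulVec, ← Matrix.dotProduct_mulVec, Matrix.mulVec_mulVec,
      ← Matrix.star_eq_conjTranspose, Matrix.mem_unitaryGroup_iff'.1 hU, Matrix.one_mulVec]
  have h' := Complex.ofReal_injective h
  rwa [pow_left_inj₀ (amplitudeNorm_nonneg _) (amplitudeNorm_nonneg _) two_ne_zero] at h'

theorem amplitudeNorm_prod_sq {κ : Type*} [Fintype κ] (f : ι × κ → ℂ) :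
    amplitudeNorm f ^ 2 = ∑ w, amplitudeNorm (fun q => f (q, w)) ^ 2 := by
  simp only [amplitudeNorm_sq, Fintype.sum_prod_type_right]

end amplitudeNorm

theorem blockDiagonal_mulVec_apply {Q κ : Type*} [Fintype Q] [Fintype κ] [DecidableEq κ]
    (M : κ → Matrix Q Q ℂ) (f : Q × κ → ℂ) (q : Q) (w : κ) :
    (Matrix.blockDiagonal M).mulVec f (q, w) = (M w).mulVec (fun q' => f (q', w)) q := by
  simp [Matrix.mulVec, dotProduct, Matrix.blockDiagonal_apply, Fintype.sum_prod_type, ite_mul]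

/-- The probability of measuring an outcome in `S`. -/
noncomputable def outcomeProb {ι : Type*} [Fintype ι] (S : Set ι) (f : ι → ℂ) : ℝ :=
  amplitudeNorm (S.indicator f) ^ 2

section outcomeProb

variable {ι : Type*} [Fintype ι]

theorem amplitudeNorm_indicator_le (S : Set ι) (f : ι → ℂ) :
    amplitudeNorm (S.indicator f) ≤ amplitudeNorm f := by
  rw [← pow_le_pow_iff_left₀ (amplitudeNorm_nonneg _) (amplitudeNorm_nonneg _) two_ne_zero,
    amplitudeNorm_sq, amplitudeNorm_sq]
  gcongr with z
  exact norm_indicator_le_norm_self f z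

/-- Factor the difference of squares `a ^ 2 - b ^ 2 = (a - b) (a + b)`, where `a` and `b` are at
most 1. -/
theorem outcomeProb_le_add (S : Set ι) {f g : ι → ℂ} (hf : amplitudeNorm f = 1)
    (hg : amplitudeNorm g = 1) :
    outcomeProb S f ≤ outcomeProb S g + 2 * amplitudeNorm (f - g) := by
  have h1 : amplitudeNorm (S.indicator f) ≤ amplitudeNorm (S.indicator g) + amplitudeNorm (f - g) := by
    calc amplitudeNorm (S.indicator f)
        = amplitudeNorm (S.indicator g + S.indicator (f - g)) := by
          rw [← Set.indicator_add', add_sub_cancel]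
      _ ≤ _ := (amplitudeNorm_add_le _ _).trans (by gcongr; exact amplitudeNorm_indicator_le _ _)
  have h2 := amplitudeNorm_indicator_le S f
  have h3 := amplitudeNorm_indicator_le S g
  have h4 := amplitudeNorm_nonneg (S.indicator f)
  have h5 := amplitudeNorm_nonneg (S.indicator g)
  have h6 := amplitudeNorm_nonneg (f - g)
  unfold outcomeProb
  rw [hf] at h2
  rw [hg] at h3
  nlinarith

theorem outcomeProb_add_le {S T : Set ι} (h : Disjoint S T) (f : ι → ℂ) :
    outcomeProb S f + outcomeProb T f ≤ amplitudeNorm f ^ 2 := by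
  simp only [outcomeProb, amplitudeNorm_sq]
  rw [← sum_add_distrib]
  refine sum_le_sum fun z _ => ?_
  by_cases hS : z ∈ S
  · simp [hS, Set.disjoint_left.1 h hS]
  · by_cases hT : z ∈ T <;> simp [hS, hT]

end outcomeProb

/-! ### Queries and the hybrid argument. -/

theorem QueryMode.toMatrix_mem_unitaryGroup {Q : Type} [Fintype Q] [DecidableEq Q]
    {U : Matrix Q Q ℂ} (hU : U ∈ Matrix.unitaryGroup Q ℂ) (μ : QueryMode) :
    μ.toMatrix U ∈ Matrix.unitaryGroup Q ℂ := by
  cases μ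
  · exact one_mem _
  · exact hU
  · exact Unitary.star_mem hU

theorem QueryMode.toMatrix_one {Q : Type} [Fintype Q] [DecidableEq Q] (μ : QueryMode) :
    μ.toMatrix (1 : Matrix Q Q ℂ) = 1 := by
  cases μ <;> simp [QueryMode.toMatrix]

theorem QueryMode.amplitudeNorm_toMatrix_sub_one_le {Q : Type} [Fintype Q] [DecidableEq Q]
    {U : Matrix Q Q ℂ} (hU : U ∈ Matrix.unitaryGroup Q ℂ) (μ : QueryMode) (f : Q → ℂ) :
    amplitudeNorm ((μ.toMatrix U - 1).mulVec f) ≤ amplitudeNorm ((U - 1).mulVec f) := by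
  cases μ
  · simp [QueryMode.toMatrix, amplitudeNorm]
  · exact le_rfl
  -- The adjoint is as close to the identity as `U` on each vector, since unitary factors preserve
  -- norms.
  · have h : U.conjTranspose - 1 = -(star U * (U - 1)) := by
      rw [mul_sub, Matrix.mem_unitaryGroup_iff'.1 hU, Matrix.star_eq_conjTranspose]
      simp
    rw [QueryMode.toMatrix, h, Matrix.neg_mulVec, amplitudeNorm_neg, ← Matrix.mulVec_mulVec,
      amplitudeNorm_unitary_mulVec (Unitary.star_mem hU)]

namespace QueryAlgorithm

variable {Q : Type} [Fintype Q] [DecidableEq Q] (A : QueryAlgorithm Q)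

theorem amplitudeNorm_queryMatrix_mulVec {U : Matrix Q Q ℂ} (hU : U ∈ Matrix.unitaryGroup Q ℂ)
    (t : ℕ) (f : Q × Fin A.dim → ℂ) :
    amplitudeNorm ((A.queryMatrix U t).mulVec f) = amplitudeNorm f := by
  rw [← pow_left_inj₀ (amplitudeNorm_nonneg _) (amplitudeNorm_nonneg _) two_ne_zero,
    amplitudeNorm_prod_sq, amplitudeNorm_prod_sq]
  refine sum_congr rfl fun w _ => ?_
  simp only [queryMatrix, blockDiagonal_mulVec_apply]
  rw [amplitudeNorm_unitary_mulVec (QueryMode.toMatrix_mem_unitaryGroup hU _)]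

theorem queryMatrix_one (t : ℕ) : A.queryMatrix 1 t = 1 := by
  simp only [queryMatrix, QueryMode.toMatrix_one]
  exact Matrix.blockDiagonal_one

theorem amplitudeNorm_queryMatrix_sub_one_le {U : Matrix Q Q ℂ}
    (hU : U ∈ Matrix.unitaryGroup Q ℂ) (t : ℕ) (f : Q × Fin A.dim → ℂ) :
    amplitudeNorm ((A.queryMatrix U t - 1).mulVec f) ^ 2 ≤
      ∑ w, amplitudeNorm ((U - 1).mulVec fun q => f (q, w)) ^ 2 := by
  rw [amplitudeNorm_prod_sq]
  refine sum_le_sum fun w _ => ?_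
  refine pow_le_pow_left₀ (amplitudeNorm_nonneg _) ?_ 2
  refine le_trans (le_of_eq ?_) (QueryMode.amplitudeNorm_toMatrix_sub_one_le hU (A.mode t w) _)
  congr 1
  ext q
  simp [queryMatrix, Matrix.sub_mulVec, blockDiagonal_mulVec_apply]

theorem amplitudeNorm_state {U : Matrix Q Q ℂ} (hU : U ∈ Matrix.unitaryGroup Q ℂ) (t : ℕ) :
    amplitudeNorm (A.state U t) = 1 := by
  induction t with
  | zero => rw [state, amplitudeNorm_unitary_mulVec (A.unitary 0).2, amplitudeNorm_single]
  | succ t ih =>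
    rw [state, amplitudeNorm_unitary_mulVec (A.unitary (t + 1)).2,
      A.amplitudeNorm_queryMatrix_mulVec hU, ih]

/-- The hybrid argument, with the identity as the reference oracle. -/
theorem amplitudeNorm_state_sub_le {U : Matrix Q Q ℂ} (hU : U ∈ Matrix.unitaryGroup Q ℂ) (t : ℕ) :
    amplitudeNorm (A.state U t - A.state 1 t) ≤
      ∑ i ∈ range t, amplitudeNorm ((A.queryMatrix U i - 1).mulVec (A.state 1 i)) := by
  induction t with
  | zero => simp [state, amplitudeNorm]
  | succ t ih =>
    -- The old error is carried along isometrically. The new error is measured on the reference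
    -- state, which does not depend on `U`; this is what later permits averaging over `U`.
    have h : A.state U (t + 1) - A.state 1 (t + 1) =
        (A.unitary (t + 1) : Matrix (Q × Fin A.dim) (Q × Fin A.dim) ℂ).mulVec
          ((A.queryMatrix U t).mulVec (A.state U t - A.state 1 t) +
            (A.queryMatrix U t - 1).mulVec (A.state 1 t)) := by
      simp only [state, queryMatrix_one, ← Matrix.mulVec_sub]
      congr 1
      simp [Matrix.mulVec_sub, Matrix.sub_mulVec]
    rw [h, amplitudeNorm_unitary_mulVec (A.unitary (t + 1)).2, sum_range_succ]
    refine (amplitudeNorm_add_le _ _).trans ?_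
    rw [A.amplitudeNorm_queryMatrix_mulVec hU]
    gcongr

theorem estimateProb_eq_outcomeProb (U : Matrix Q Q ℂ) (γ x : ℝ) :
    A.estimateProb U γ x =
      outcomeProb {z | x / γ ≤ A.output z ∧ A.output z ≤ γ * x} (A.state U A.queries) := by
  classical
  rw [estimateProb, outcomeProb, amplitudeNorm_sq]
  refine sum_congr rfl fun z _ => ?_
  by_cases hz : x / γ ≤ A.output z ∧ A.output z ≤ γ * x
  · simp [hz]
  · rw [if_neg hz, Set.indicator_of_notMem (by simpa using hz)]
    simp

end QueryAlgorithm

/-! ### Random oracles near the identity and the resulting query bound. -/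

/-- The random oracle that is `U i` with probability `w i` deviates from the identity by at most
`√D` in quadratic mean, on every fixed state. -/
structure NearIdentity {Q ι : Type*} [Fintype Q] [DecidableEq Q] [Fintype ι] (w : ι → ℝ)
    (U : ι → Matrix Q Q ℂ) (D : ℝ) : Prop where
  weight_nonneg : ∀ i, 0 ≤ w i
  weight_sum : ∑ i, w i = 1
  unitary : ∀ i, U i ∈ Matrix.unitaryGroup Q ℂ
  deviation : ∀ f : Q → ℂ,
    ∑ i, w i * amplitudeNorm ((U i - 1).mulVec f) ^ 2 ≤ D * amplitudeNorm f ^ 2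

namespace NearIdentity

variable {Q : Type} {ι : Type*} [Fintype Q] [DecidableEq Q] [Fintype ι] {w : ι → ℝ}
  {U : ι → Matrix Q Q ℂ} {D : ℝ}

theorem mono (h : NearIdentity w U D) {D' : ℝ} (hD : D ≤ D') : NearIdentity w U D' :=
  ⟨h.weight_nonneg, h.weight_sum, h.unitary, fun f => (h.deviation f).trans (by gcongr)⟩

theorem sum_query_le (h : NearIdentity w U D) (A : QueryAlgorithm Q) (t : ℕ) :
    ∑ i, w i * amplitudeNorm ((A.queryMatrix (U i) t - 1).mulVec (A.state 1 t)) ≤ √D := by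
  refine Real.le_sqrt_of_sq_le ?_
  -- Jensen passes to the quadratic mean. The deviation bound then applies to each workspace slice
  -- of the fixed reference state, and the squared norms of the slices sum to 1.
  refine (Real.pow_arith_mean_le_arith_mean_pow univ w _ (fun i _ => h.weight_nonneg i)
    h.weight_sum (fun i _ => amplitudeNorm_nonneg _) 2).trans ?_
  calc ∑ i, w i * amplitudeNorm ((A.queryMatrix (U i) t - 1).mulVec (A.state 1 t)) ^ 2
      ≤ ∑ i, w i * ∑ b, amplitudeNorm ((U i - 1).mulVec fun q => A.state 1 t (q, b)) ^ 2 := by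
        refine sum_le_sum fun i _ => mul_le_mul_of_nonneg_left ?_ (h.weight_nonneg i)
        exact A.amplitudeNorm_queryMatrix_sub_one_le (h.unitary i) t _
    _ = ∑ b, ∑ i, w i * amplitudeNorm ((U i - 1).mulVec fun q => A.state 1 t (q, b)) ^ 2 := by
        simp only [mul_sum]
        exact sum_comm
    _ ≤ ∑ b, D * amplitudeNorm (fun q => A.state 1 t (q, b)) ^ 2 :=
        sum_le_sum fun b _ => h.deviation _
    _ = D := by
        rw [← mul_sum, ← amplitudeNorm_prod_sq, A.amplitudeNorm_state (one_mem _)]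
        simp

theorem sum_estimateProb_le (h : NearIdentity w U D) (A : QueryAlgorithm Q) (γ x : ℝ) :
    ∑ i, w i * A.estimateProb (U i) γ x ≤ A.estimateProb 1 γ x + 2 * (A.queries * √D) := by
  simp only [A.estimateProb_eq_outcomeProb]
  set S := {z | x / γ ≤ A.output z ∧ A.output z ≤ γ * x}
  calc ∑ i, w i * outcomeProb S (A.state (U i) A.queries)
      ≤ ∑ i, w i * (outcomeProb S (A.state 1 A.queries) + 2 * ∑ t ∈ range A.queries,
          amplitudeNorm ((A.queryMatrix (U i) t - 1).mulVec (A.state 1 t))) := by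
        refine sum_le_sum fun i _ => mul_le_mul_of_nonneg_left ?_ (h.weight_nonneg i)
        refine (outcomeProb_le_add S (A.amplitudeNorm_state (h.unitary i) _)
          (A.amplitudeNorm_state (one_mem _) A.queries)).trans ?_
        gcongr
        exact A.amplitudeNorm_state_sub_le (h.unitary i) _
    _ = outcomeProb S (A.state 1 A.queries) + 2 * ∑ t ∈ range A.queries, ∑ i,
          w i * amplitudeNorm ((A.queryMatrix (U i) t - 1).mulVec (A.state 1 t)) := by
        rw [sum_comm]
        simp only [mul_add, sum_add_distrib, ← sum_mul, h.weight_sum, one_mul, mul_sum]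
        congr 1
        exact sum_congr rfl fun i _ => sum_congr rfl fun t _ => by ring
    _ ≤ _ := by
        gcongr
        refine (sum_le_sum fun t _ => h.sum_query_le A t).trans ?_
        simp

end NearIdentity

/-- The intervals of acceptable outputs are disjoint, because `γ x < y / γ`. -/
theorem QueryAlgorithm.estimateProb_one_add_le {Q : Type} [Fintype Q] [DecidableEq Q]
    (A : QueryAlgorithm Q) {γ x y : ℝ} (hγ : 1 < γ) (hxy : γ ^ 2 * x < y) :
    A.estimateProb 1 γ x + A.estimateProb 1 γ y ≤ 1 := by
  rw [A.estimateProb_eq_outcomeProb, A.estimateProb_eq_outcomeProb]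
  refine (outcomeProb_add_le ?_ _).trans (by rw [A.amplitudeNorm_state (one_mem _)]; norm_num)
  rw [Set.disjoint_left]
  rintro z ⟨-, hz⟩ ⟨hz', -⟩
  have h0 : 0 < γ := by linarith
  rw [div_le_iff₀ h0] at hz'
  nlinarith

/-- An algorithm that estimates correctly on two random oracles near the identity, for two values
that are more than a factor `γ ^ 2` apart, makes many queries. -/
theorem two_mul_le_of_nearIdentity {Q : Type} {ι κ : Type*} [Fintype Q] [DecidableEq Q]
    [Fintype ι] [Fintype κ] {w : ι → ℝ} {U : ι → Matrix Q Q ℂ} {w' : κ → ℝ}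
    {U' : κ → Matrix Q Q ℂ} {D : ℝ} (h : NearIdentity w U D) (h' : NearIdentity w' U' D)
    (A : QueryAlgorithm Q) {γ x y s : ℝ} (hγ : 1 < γ) (hxy : γ ^ 2 * x < y)
    (hx : s ≤ ∑ i, w i * A.estimateProb (U i) γ x)
    (hy : s ≤ ∑ i, w' i * A.estimateProb (U' i) γ y) :
    2 * s ≤ 1 + 4 * (A.queries * √D) := by
  have h1 := h.sum_estimateProb_le A γ x
  have h2 := h'.sum_estimateProb_le A γ y
  have h3 := A.estimateProb_one_add_le hγ hxy
  linarith

/-! ### String oracles: frequency vectors and sample lists. -/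

theorem sum_prod_mul_apply {m n : ℕ} {p : Fin n → ℝ} (hp : ∑ i, p i = 1) (g : Fin n → ℝ) (j : Fin m) :
    ∑ v : Fin m → Fin n, (∏ k, p (v k)) * g (v j) = ∑ i, p i * g i := by
  -- Written as a product over all coordinates, the summand factorises; every coordinate other than
  -- `j` contributes a factor 1.
  have h : ∀ v : Fin m → Fin n, (∏ k, p (v k)) * g (v j) =
      ∏ k, p (v k) * (if k = j then g (v k) else 1) := fun v => by
    rw [prod_mul_distrib, prod_ite_eq' univ j fun k => g (v k), if_pos (mem_univ j)]
  simp only [h]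
  rw [← Fintype.piFinset_univ, ← prod_univ_sum (fun _ => univ)
    (fun k i => p i * (if k = j then g i else 1)), prod_eq_single j]
  · simp
  · intro k _ hk
    simp [hk, hp]
  · simp

theorem frequency_comp_equiv {m n : ℕ} (v : Fin m → Fin n) (e : Fin m ≃ Fin m) :
    frequency (v ∘ e) = frequency v := by
  ext i
  simp only [frequency]
  congr 2
  exact card_equiv e (by simp)

theorem frequency_mem_stdSimplex {m n : ℕ} [NeZero m] (v : Fin m → Fin n) :
    frequency v ∈ stdSimplex ℝ (Fin n) := by
  refine ⟨fun i => by unfold frequency; positivity, ?_⟩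
  have hm : (m : ℝ) ≠ 0 := by exact_mod_cast NeZero.ne m
  simp only [frequency]
  rw [← sum_div, div_eq_one_iff_eq hm, ← Nat.cast_sum,
    ← card_eq_sum_card_fiberwise (fun j _ => mem_coe.2 (mem_univ (v j)))]
  simp

section stringOracle

variable {m n : ℕ} [NeZero n]

theorem stringOracle_mulVec_apply (v : Fin m → Fin n) (f : Fin m × Fin n → ℂ) (j : Fin m)
    (b : Fin n) : (stringOracle v).mulVec f (j, b) = f (j, b - v j) := by
  simp only [Matrix.mulVec, dotProduct, stringOracle, Matrix.of_apply, Fintype.sum_prod_type]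
  rw [sum_eq_single j, sum_eq_single (b - v j)]
  · simp
  · intro d _ hd
    rw [if_neg, zero_mul]
    rintro ⟨-, rfl⟩
    simp at hd
  · simp
  · intro l _ hl
    simp [hl.symm]
  · simp

/-- Only blocks with a nonzero letter move. There the oracle permutes amplitudes, and `‖a - b‖ ^ 2 ≤
2 ‖a‖ ^ 2 + 2 ‖b‖ ^ 2` gives the factor 4. -/
theorem amplitudeNorm_stringOracle_sub_one_le (v : Fin m → Fin n) (f : Fin m × Fin n → ℂ) :
    amplitudeNorm ((stringOracle v - 1).mulVec f) ^ 2 ≤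
      ∑ j, (if v j = 0 then 0 else 1) * (4 * ∑ b, ‖f (j, b)‖ ^ 2) := by
  rw [amplitudeNorm_sq, Fintype.sum_prod_type]
  refine sum_le_sum fun j _ => ?_
  simp only [Matrix.sub_mulVec, Matrix.one_mulVec, Pi.sub_apply, stringOracle_mulVec_apply]
  split_ifs with h
  · simp [h]
  · have h1 : ∑ b, ‖f (j, b - v j)‖ ^ 2 = ∑ b, ‖f (j, b)‖ ^ 2 :=
      (Equiv.subRight (v j)).sum_comp fun b => ‖f (j, b)‖ ^ 2
    calc ∑ b, ‖f (j, b - v j) - f (j, b)‖ ^ 2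
        ≤ ∑ b, (2 * ‖f (j, b - v j)‖ ^ 2 + 2 * ‖f (j, b)‖ ^ 2) := by
          refine sum_le_sum fun b _ => ?_
          have h2 := norm_sub_le (f (j, b - v j)) (f (j, b))
          have h3 := norm_nonneg (f (j, b - v j) - f (j, b))
          nlinarith [sq_nonneg (‖f (j, b - v j)‖ - ‖f (j, b)‖)]
      _ = _ := by
          rw [sum_add_distrib, ← mul_sum, ← mul_sum, h1]
          ring

/-- A random string oracle is near the identity if every letter is mostly zero. -/
theorem nearIdentity_stringOracle {ι : Type*} [Fintype ι] {w : ι → ℝ} (hw : ∀ i, 0 ≤ w i)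
    (hw1 : ∑ i, w i = 1) (v : ι → Fin m → Fin n) {σ : ℝ}
    (h : ∀ j, ∑ i, w i * (if v i j = 0 then 0 else 1) ≤ σ) :
    NearIdentity w (fun i => stringOracle (v i)) (4 * σ) where
  weight_nonneg := hw
  weight_sum := hw1
  unitary i := stringOracle_mem_unitaryGroup (v i)
  deviation f := by
    calc ∑ i, w i * amplitudeNorm ((stringOracle (v i) - 1).mulVec f) ^ 2
        ≤ ∑ i, w i * ∑ j, (if v i j = 0 then 0 else 1) * (4 * ∑ b, ‖f (j, b)‖ ^ 2) :=
          sum_le_sum fun i _ => mul_le_mul_of_nonneg_left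
            (amplitudeNorm_stringOracle_sub_one_le (v i) f) (hw i)
      _ = ∑ j, (∑ i, w i * (if v i j = 0 then 0 else 1)) * (4 * ∑ b, ‖f (j, b)‖ ^ 2) := by
          simp only [mul_sum, sum_mul]
          rw [sum_comm]
          refine sum_congr rfl fun j _ => ?_
          rw [sum_comm]
          simp only [mul_assoc]
      _ ≤ ∑ j, σ * (4 * ∑ b, ‖f (j, b)‖ ^ 2) := by
          gcongr with j
          exact h j
      _ = 4 * σ * amplitudeNorm f ^ 2 := by
          rw [amplitudeNorm_sq, Fintype.sum_prod_type, ← mul_sum, ← mul_sum]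
          ring

theorem nearIdentity_sampleList {p : Fin n → ℝ} (hp : p ∈ stdSimplex ℝ (Fin n)) :
    NearIdentity (fun v : Fin m → Fin n => ∏ j, p (v j)) stringOracle (4 * (1 - p 0)) := by
  refine nearIdentity_stringOracle (fun v => prod_nonneg fun j _ => hp.1 _) ?_ (fun v => v) ?_
  · rw [← Fintype.piFinset_univ, ← prod_univ_sum (fun _ => univ) (fun _ i => p i)]
    simp [hp.2]
  · intro j
    rw [sum_prod_mul_apply hp.2 (fun i => if i = 0 then 0 else 1) j]
    have h : ∀ i, p i * (if i = 0 then 0 else 1) = p i - if i = 0 then p i else 0 := by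
      intro i
      split_ifs <;> simp
    simp [h, hp.2]

/-- A single string may be far from the identity on some state. A uniformly random cyclic shift
makes each entry a uniform sample of `v` and keeps the frequencies. -/
theorem nearIdentity_shift [NeZero m] (v : Fin m → Fin n) :
    NearIdentity (fun _ : Fin m => (1 / m : ℝ))
      (fun r => stringOracle (v ∘ Equiv.addRight r)) (4 * (1 - frequency v 0)) := by
  have hm : (m : ℝ) ≠ 0 := by exact_mod_cast NeZero.ne m
  refine nearIdentity_stringOracle (fun _ => by positivity) (by simp [hm])
    (fun r => v ∘ Equiv.addRight r) fun j => ?_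
  have h1 : ∑ r, (if v (j + r) = 0 then 0 else 1 : ℝ) = ∑ r, (if v r = 0 then 0 else 1 : ℝ) :=
    Equiv.sum_comp (Equiv.addLeft j) fun r => if v r = 0 then (0 : ℝ) else 1
  have h2 : ∑ r, (if v r = 0 then 0 else 1 : ℝ) = m - #{j | v j = 0} := by
    have h3 : ∀ r, (if v r = 0 then 0 else 1 : ℝ) = 1 - if v r = 0 then 1 else 0 := by
      intro r
      split_ifs <;> simp
    simp only [h3, sum_sub_distrib, sum_boole]
    simp
  refine le_of_eq ?_
  rw [← mul_sum]
  refine (congrArg ((1 / m : ℝ) * ·) (h1.trans h2)).trans ?_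
  simp only [frequency]
  field_simp

end stringOracle

/-! ### State preparation by plane rotations. -/

section rotation

open Matrix

variable {Q : Type*} [Fintype Q] [DecidableEq Q]

/-- For `c` and `r` with `r z = 0` and `c ^ 2 + ‖r‖ ^ 2 = 1`, the rotation in the plane of
`|z⟩` and `r` that maps `|z⟩` to `c |z⟩ + r`. -/
noncomputable def planeRotation (z : Q) (c : ℝ) (r : Q → ℂ) : Matrix Q Q ℂ :=
  1 + ((c : ℂ) - 1) • vecMulVec (Pi.single z 1) (Pi.single z 1)
    - (1 / (1 + c) : ℂ) • vecMulVec r (star r)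
    + (vecMulVec r (Pi.single z 1) - vecMulVec (Pi.single z 1) (star r))

variable {z : Q} {c : ℝ} {r : Q → ℂ}

theorem planeRotation_mulVec (f : Q → ℂ) : (planeRotation z c r - 1).mulVec f =
    ((c - 1 : ℂ) * f z) • Pi.single z 1 + (-(1 / (1 + c) : ℂ) * (star r ⬝ᵥ f)) • r
      + (f z • r + (-(star r ⬝ᵥ f)) • Pi.single z 1) := by
  ext q
  simp [planeRotation, add_mulVec, sub_mulVec, smul_mulVec, vecMulVec_mulVec]
  ring

theorem planeRotation_mulVec_single (hr : r z = 0) :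
    (planeRotation z c r).mulVec (Pi.single z 1) = (c : ℂ) • Pi.single z 1 + r := by
  have h : planeRotation z c r = 1 + (planeRotation z c r - 1) := by abel
  rw [h, add_mulVec, planeRotation_mulVec, one_mulVec]
  ext q
  simp [hr]
  ring

/-- The coefficient `1 / (1 + c)` equals `(1 - c) / ‖r‖ ^ 2` when `r ≠ 0`, so `r` is scaled by `c`
within its own direction; this form also covers `r = 0`. The proof multiplies out the rank-one
terms. -/
theorem planeRotation_mem_unitaryGroup (hc : 0 ≤ c) (hr : r z = 0)
    (h : c ^ 2 + amplitudeNorm r ^ 2 = 1) : planeRotation z c r ∈ Matrix.unitaryGroup Q ℂ := by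
  have hrr : star r ⬝ᵥ r = 1 - (c : ℂ) ^ 2 := by
    have h1 : ((amplitudeNorm r ^ 2 : ℝ) : ℂ) = star r ⬝ᵥ r := by
      rw [amplitudeNorm_sq]
      simp only [dotProduct, Pi.star_apply, RCLike.star_def, Complex.ofReal_sum]
      exact sum_congr rfl fun z _ => by rw [Complex.conj_mul']; simp
    rw [← h1, eq_sub_of_add_eq' h]
    push_cast
    rfl
  have hc' : (1 + c : ℂ) ≠ 0 := by
    exact_mod_cast (by positivity : (1 + c : ℝ) ≠ 0)
  rw [mem_unitaryGroup_iff']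
  have hstar : star (planeRotation z c r) =
      1 + ((c : ℂ) - 1) • vecMulVec (Pi.single z 1) (Pi.single z 1)
    - (1 / (1 + c) : ℂ) • vecMulVec r (star r)
    - (vecMulVec r (Pi.single z 1) - vecMulVec (Pi.single z 1) (star r)) := by
    simp [planeRotation, star_eq_conjTranspose, conjTranspose_vecMulVec, Pi.star_single]
    abel
  rw [hstar, planeRotation]
  set e : Q → ℂ := Pi.single z 1 with he
  have hee : e ⬝ᵥ e = 1 := by simp [he]
  have her : e ⬝ᵥ r = 0 := by simp [he, hr]
  have hre : star r ⬝ᵥ e = 0 := by simp [he, hr]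
  have p1 : vecMulVec e e * vecMulVec e e = vecMulVec e e := by simp [vecMulVec_mul_vecMulVec, hee]
  have p2 : vecMulVec e e * vecMulVec r (star r) = 0 := by simp [vecMulVec_mul_vecMulVec, her]
  have p3 : vecMulVec e e * vecMulVec r e = 0 := by simp [vecMulVec_mul_vecMulVec, her]
  have p4 : vecMulVec e e * vecMulVec e (star r) = vecMulVec e (star r) := by
    simp [vecMulVec_mul_vecMulVec, hee]
  have q1 : vecMulVec r (star r) * vecMulVec e e = 0 := by simp [vecMulVec_mul_vecMulVec, hre]
  have q2 : vecMulVec r (star r) * vecMulVec r (star r) =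
      (1 - (c : ℂ) ^ 2) • vecMulVec r (star r) := by
    simp [vecMulVec_mul_vecMulVec, hrr, vecMulVec_smul]
  have q3 : vecMulVec r (star r) * vecMulVec r e = (1 - (c : ℂ) ^ 2) • vecMulVec r e := by
    simp [vecMulVec_mul_vecMulVec, hrr, vecMulVec_smul]
  have q4 : vecMulVec r (star r) * vecMulVec e (star r) = 0 := by
    simp [vecMulVec_mul_vecMulVec, hre]
  have r1 : vecMulVec r e * vecMulVec e e = vecMulVec r e := by simp [vecMulVec_mul_vecMulVec, hee]
  have r2 : vecMulVec r e * vecMulVec r (star r) = 0 := by simp [vecMulVec_mul_vecMulVec, her]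
  have r3 : vecMulVec r e * vecMulVec r e = 0 := by simp [vecMulVec_mul_vecMulVec, her]
  have r4 : vecMulVec r e * vecMulVec e (star r) = vecMulVec r (star r) := by
    simp [vecMulVec_mul_vecMulVec, hee]
  have t1 : vecMulVec e (star r) * vecMulVec e e = 0 := by simp [vecMulVec_mul_vecMulVec, hre]
  have t2 : vecMulVec e (star r) * vecMulVec r (star r) =
      (1 - (c : ℂ) ^ 2) • vecMulVec e (star r) := by
    simp [vecMulVec_mul_vecMulVec, hrr, vecMulVec_smul]
  have t3 : vecMulVec e (star r) * vecMulVec r e = (1 - (c : ℂ) ^ 2) • vecMulVec e e := by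
    simp [vecMulVec_mul_vecMulVec, hrr, vecMulVec_smul]
  have t4 : vecMulVec e (star r) * vecMulVec e (star r) = 0 := by
    simp [vecMulVec_mul_vecMulVec, hre]
  simp only [mul_add, add_mul, mul_sub, sub_mul, one_mul, mul_one, smul_mul_assoc, mul_smul_comm,
    p1, p2, p3, p4, q1, q2, q3, q4, r1, r2, r3, r4, t1, t2, t3, t4, smul_zero]
  match_scalars <;> field_simp <;> ring

/-- Each of the four rank-one terms has norm at most `‖r‖ ‖f‖`; for the first, `1 - c ≤ 1 - c ^ 2 =
‖r‖ ^ 2 ≤ ‖r‖`. -/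
theorem amplitudeNorm_planeRotation_sub_one_le (hc : 0 ≤ c)
    (h : c ^ 2 + amplitudeNorm r ^ 2 = 1) (f : Q → ℂ) :
    amplitudeNorm ((planeRotation z c r - 1).mulVec f) ≤
      4 * amplitudeNorm r * amplitudeNorm f := by
  set a := amplitudeNorm r with ha
  set N := amplitudeNorm f with hN
  have ha0 : 0 ≤ a := amplitudeNorm_nonneg _
  have hN0 : 0 ≤ N := amplitudeNorm_nonneg _
  have ha1 : a ≤ 1 := by nlinarith
  have hc1 : c ≤ 1 := by nlinarith
  have hf : ‖f z‖ ≤ N := norm_apply_le_amplitudeNorm f z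
  have hstar : amplitudeNorm (star r) = a := by
    rw [ha, ← pow_left_inj₀ (amplitudeNorm_nonneg _) (amplitudeNorm_nonneg _) two_ne_zero,
      amplitudeNorm_sq, amplitudeNorm_sq]
    simp
  have hrf : ‖star r ⬝ᵥ f‖ ≤ a * N := by
    have := norm_dotProduct_le (star r) f
    rwa [hstar] at this
  have hk : ‖(1 / (1 + c) : ℂ)‖ ≤ 1 := by
    rw [show (1 / (1 + c) : ℂ) = ((1 / (1 + c) : ℝ) : ℂ) by push_cast; rfl, Complex.norm_real,
      Real.norm_of_nonneg (by positivity)]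
    exact div_le_one_of_le₀ (by linarith) (by linarith)
  have hc2 : ‖(c - 1 : ℂ)‖ ≤ a := by
    rw [show (c - 1 : ℂ) = ((c - 1 : ℝ) : ℂ) by push_cast; rfl, Complex.norm_real,
      Real.norm_of_nonpos (by linarith)]
    nlinarith
  rw [planeRotation_mulVec]
  refine (amplitudeNorm_add_le _ _).trans ?_
  refine (add_le_add (amplitudeNorm_add_le _ _) (amplitudeNorm_add_le _ _)).trans ?_
  simp only [amplitudeNorm_smul, amplitudeNorm_single, norm_mul, norm_neg, mul_one, ← ha]
  have e1 : ‖(c - 1 : ℂ)‖ * ‖f z‖ ≤ a * N := by gcongr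
  have e2 : ‖(1 / (1 + c) : ℂ)‖ * ‖star r ⬝ᵥ f‖ * a ≤ 1 * (a * N) * 1 := by gcongr
  have e3 : ‖f z‖ * a ≤ N * a := by gcongr
  linarith

theorem nearIdentity_planeRotation (hc : 0 ≤ c) (hr : r z = 0)
    (h : c ^ 2 + amplitudeNorm r ^ 2 = 1) :
    NearIdentity (fun _ : Unit => (1 : ℝ)) (fun _ => planeRotation z c r) (16 * (1 - c ^ 2)) where
  weight_nonneg _ := zero_le_one
  weight_sum := by simp
  unitary _ := planeRotation_mem_unitaryGroup hc hr h
  deviation f := by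
    have h1 := amplitudeNorm_planeRotation_sub_one_le (z := z) hc h f
    have h2 := pow_le_pow_left₀ (amplitudeNorm_nonneg _) h1 2
    have h3 : 1 - c ^ 2 = amplitudeNorm r ^ 2 := by linarith
    rw [h3]
    simp only [univ_unique, one_mul, sum_singleton]
    linarith

end rotation

section preparation

variable {n : ℕ} [NeZero n] {p : Fin n → ℝ}

theorem sum_erase_zero (hp : p ∈ stdSimplex ℝ (Fin n)) :
    ∑ i, (if i = 0 then 0 else p i) = 1 - p 0 := by
  rw [← hp.2, ← add_sum_erase univ p (mem_univ 0), add_sub_cancel_left,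
    ← add_sum_erase univ _ (mem_univ 0), if_pos rfl, zero_add]
  exact sum_congr rfl fun i hi => if_neg (ne_of_mem_erase hi)

theorem exists_preparesQuantumSample (hp : p ∈ stdSimplex ℝ (Fin n)) :
    ∃ U : Matrix (Fin n) (Fin n) ℂ, PreparesQuantumSample p U ∧
      NearIdentity (fun _ : Unit => (1 : ℝ)) (fun _ => U) (16 * (1 - p 0)) := by
  set r : Fin n → ℂ := fun i => if i = 0 then 0 else (√(p i) : ℂ) with hr
  have hr0 : r 0 = 0 := by simp [hr]
  have hnorm : √(p 0) ^ 2 + amplitudeNorm r ^ 2 = 1 := by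
    have h : ∀ i, ‖r i‖ ^ 2 = if i = 0 then 0 else p i := by
      intro i
      by_cases hi : i = 0
      · simp [hr, hi]
      · simp [hr, hi, Real.sq_sqrt (hp.1 i)]
    rw [amplitudeNorm_sq, Real.sq_sqrt (hp.1 0)]
    simp only [h, sum_erase_zero hp]
    ring
  refine ⟨planeRotation 0 (√(p 0)) r, ?_, ?_⟩
  · rw [PreparesQuantumSample, planeRotation_mulVec_single hr0]
    ext i
    by_cases hi : i = 0
    · simp [hr, hi]
    · simp [hr, hi]
  · have := nearIdentity_planeRotation (Real.sqrt_nonneg _) hr0 hnorm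
    rwa [Real.sq_sqrt (hp.1 0)] at this

theorem exists_preparesPurification (hp : p ∈ stdSimplex ℝ (Fin n)) :
    ∃ U : Matrix (Fin n × Fin n) (Fin n × Fin n) ℂ, PreparesPurification p U ∧
      NearIdentity (fun _ : Unit => (1 : ℝ)) (fun _ => U) (16 * (1 - p 0)) := by
  set r : Fin n × Fin n → ℂ :=
    fun x => if x.1 = x.2 then (if x.2 = 0 then 0 else (√(p x.2) : ℂ)) else 0 with hr
  have hr0 : r (0, 0) = 0 := by simp [hr]
  have hnorm : √(p 0) ^ 2 + amplitudeNorm r ^ 2 = 1 := by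
    have h : ∀ i j, ‖r (j, i)‖ ^ 2 = if j = i then (if i = 0 then 0 else p i) else 0 := by
      intro i j
      by_cases hi : i = 0
      · simp [hr, hi]
      · by_cases hj : j = i <;> simp [hr, hi, hj, Real.sq_sqrt (hp.1 i)]
    rw [amplitudeNorm_sq, Real.sq_sqrt (hp.1 0), Fintype.sum_prod_type_right]
    simp only [h, sum_ite_eq', mem_univ, if_true, sum_erase_zero hp]
    ring
  refine ⟨planeRotation (0, 0) (√(p 0)) r, ?_, ?_⟩
  -- The purifying vectors are the basis vectors: the state is `∑ √pᵢ |i⟩|i⟩`.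
  · refine ⟨fun i => EuclideanSpace.single i 1, EuclideanSpace.orthonormal_single, ?_⟩
    rw [planeRotation_mulVec_single hr0]
    ext ⟨j, i⟩
    by_cases hj : j = i
    · subst hj
      by_cases hj0 : j = 0
      · simp [hr, hj0]
      · simp [hr, hj0]
    · by_cases hi0 : i = 0
      · subst hi0
        simp [hr, hj]
      · simp [hr, hj, hi0]
  · have := nearIdentity_planeRotation (Real.sqrt_nonneg _) hr0 hnorm
    rwa [Real.sq_sqrt (hp.1 0)] at this

end preparation

/-! ### Entropy and the hard pair of distributions. -/

open Filter Topology

section entropy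

variable {n : ℕ}

theorem shannonEntropy_eq_sum_negMulLog (p : Fin n → ℝ) :
    shannonEntropy p = (∑ i, Real.negMulLog (p i)) / Real.log 2 := by
  simp only [shannonEntropy, Real.logb, Real.negMulLog, ← sum_neg_distrib, sum_div]
  exact sum_congr rfl fun i _ => by ring

theorem continuous_shannonEntropy : Continuous (shannonEntropy : (Fin n → ℝ) → ℝ) := by
  simp only [funext shannonEntropy_eq_sum_negMulLog]
  exact (continuous_finsetSum _ fun i _ =>
    Real.continuous_negMulLog.comp (continuous_apply i)).div_const _

theorem shannonEntropy_two_point (x : ℝ) :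
    shannonEntropy ![1 - x, x] = Real.binEntropy x / Real.log 2 := by
  rw [shannonEntropy_eq_sum_negMulLog, Real.binEntropy_eq_negMulLog_add_negMulLog_one_sub]
  simp [add_comm]

theorem sum_ite_zero_eq [NeZero n] (a b : ℝ) :
    ∑ i : Fin n, (if i = 0 then a else b) = a + (n - 1) * b := by
  have h : ∀ i : Fin n, (if i = 0 then a else b) = b + if i = 0 then a - b else 0 := by
    intro i
    split_ifs <;> ring
  simp only [h, sum_add_distrib, sum_ite_eq', mem_univ, if_true, sum_const, card_univ,
    Fintype.card_fin, nsmul_eq_mul]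
  ring

/-- Distributions of entropy `b`, for every possible `b`. -/
theorem exists_shannonEntropy_eq [NeZero n] {b : ℝ} (h0 : 0 ≤ b) (h1 : b ≤ Real.logb 2 n) :
    ∃ p ∈ stdSimplex ℝ (Fin n), shannonEntropy p = b := by
  have hn : (n : ℝ) ≠ 0 := by exact_mod_cast NeZero.ne n
  -- The segment from the point mass at 0 to the uniform distribution; entropy runs continuously
  -- from 0 to `log n` along it.
  let q : ℝ → Fin n → ℝ := fun t i => (1 - t) * (if i = 0 then 1 else 0) + t * (1 / n)
  have hq : Continuous fun t => shannonEntropy (q t) :=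
    continuous_shannonEntropy.comp (continuous_pi fun i => by fun_prop)
  have hq0 : shannonEntropy (q 0) = 0 := by
    rw [shannonEntropy_eq_sum_negMulLog, sum_eq_zero, zero_div]
    intro i _
    by_cases hi : i = 0 <;> simp [q, hi]
  have hq1 : shannonEntropy (q 1) = Real.logb 2 n := by
    rw [shannonEntropy_eq_sum_negMulLog]
    simp [q, Real.negMulLog, Real.logb, hn]
  obtain ⟨t, ht, htb⟩ := intermediate_value_Icc zero_le_one hq.continuousOn
    (show b ∈ Set.Icc _ _ by rw [hq0, hq1]; exact ⟨h0, h1⟩)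
  refine ⟨q t, ⟨fun i => ?_, ?_⟩, htb⟩
  · have := sub_nonneg.2 ht.2
    have := ht.1
    simp only [q]
    positivity
  · simp only [q, sum_add_distrib, ← mul_sum]
    simp [hn]

/-- Two distributions that satisfy the promise, with entropies that are more than a factor `γ ^ 2`
apart, and both close to a point mass. -/
theorem exists_hard_pair [NeZero n] (hn : 2 ≤ n) {γ : ℝ} (hγ : 1 < γ) :
    ∃ p ∈ stdSimplex ℝ (Fin n), ∃ q ∈ stdSimplex ℝ (Fin n),
      shannonEntropy ![1 - min 1 (γ ^ 2 / Real.logb 2 n), min 1 (γ ^ 2 / Real.logb 2 n)]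
        < shannonEntropy p ∧
      γ ^ 2 * shannonEntropy p < shannonEntropy q ∧
      1 - p 0 < 4 * (γ ^ 2 / Real.logb 2 n) ∧ 1 - q 0 < 4 * (γ ^ 2 / Real.logb 2 n) := by
  have hn' : (2 : ℝ) ≤ n := by exact_mod_cast hn
  have hL : 0 < Real.logb 2 n := Real.logb_pos (by norm_num) (by linarith)
  have hlog2 : 0 < Real.log 2 := Real.log_pos (by norm_num)
  set L := Real.logb 2 n with hLdef
  have hγ2 : 1 < γ ^ 2 := by nlinarith
  set ε := γ ^ 2 / L with hε
  have hε0 : 0 < ε := by positivity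
  have hεL : ε * L = γ ^ 2 := by rw [hε]; field_simp
  have hbin : ∀ x, Real.binEntropy x / Real.log 2 ≤ 1 := fun x =>
    div_le_one_of_le₀ Real.binEntropy_le_log_two hlog2.le
  rw [shannonEntropy_two_point]
  rcases lt_or_ge ε (1 / 2) with h | h
  -- Taking `δ` strictly above `ε` makes both entropy inequalities strict: `h` increases strictly on
  -- `[0, 1/2]`, and `δ log n > ε log n = γ ^ 2`.
  · obtain ⟨δ, hδ1, hδ2⟩ := exists_between (lt_min h (by linarith : ε < 4 * ε))
    obtain ⟨hδ2, hδ3⟩ := lt_min_iff.1 hδ2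
    have hδ0 : 0 < δ := hε0.trans hδ1
    have h01 : (0 : Fin n) ≠ ⟨1, hn⟩ := by simp [Fin.ext_iff]
    set p : Fin n → ℝ := fun i => if i = 0 then 1 - δ else if i = ⟨1, hn⟩ then δ else 0 with hp
    set q : Fin n → ℝ := fun i => if i = 0 then 1 - δ else δ / (n - 1) with hq
    have hsum : ∀ g : ℝ → ℝ, g 0 = 0 → ∑ i, g (p i) = g (1 - δ) + g δ := by
      intro g hg
      rw [Fintype.sum_eq_add 0 ⟨1, hn⟩ h01]
      · simp [hp, h01.symm]
      · rintro i ⟨hi0, hi1⟩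
        simp [hp, hi0, hi1, hg]
    have hHp : shannonEntropy p = Real.binEntropy δ / Real.log 2 := by
      rw [shannonEntropy_eq_sum_negMulLog, hsum _ (by simp),
        Real.binEntropy_eq_negMulLog_add_negMulLog_one_sub, add_comm]
    have hn1 : (n : ℝ) - 1 ≠ 0 := by linarith
    have hn1' : (0 : ℝ) ≤ n - 1 := by linarith
    have hHq : δ * L ≤ shannonEntropy q := by
      rw [shannonEntropy_eq_sum_negMulLog, le_div_iff₀ hlog2]
      have h1 : ∀ i, Real.negMulLog (q i) =
          if i = 0 then Real.negMulLog (1 - δ) else Real.negMulLog (δ / (n - 1)) := by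
        intro i
        simp only [hq]
        split_ifs <;> rfl
      simp only [h1, sum_ite_zero_eq]
      have h2 : 0 ≤ Real.negMulLog (1 - δ) := Real.negMulLog_nonneg (by linarith) (by linarith)
      have h3 : ((n : ℝ) - 1) * Real.negMulLog (δ / (n - 1)) = δ * Real.log ((n - 1) / δ) := by
        rw [Real.negMulLog, ← inv_div ((n : ℝ) - 1) δ, Real.log_inv]
        field_simp
      have h4 : Real.log n ≤ Real.log ((n - 1) / δ) := by
        -- This needs `n δ ≤ n - 1`, which follows from `δ < 1/2` and `n ≥ 2`.
        refine Real.log_le_log (by linarith) ?_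
        rw [le_div_iff₀ hδ0]
        nlinarith
      have h5 : L * Real.log 2 = Real.log n := by
        rw [hLdef, Real.logb]
        field_simp
      rw [h3, mul_assoc, h5]
      nlinarith
    refine ⟨p, ⟨fun i => ?_, ?_⟩, q, ⟨fun i => ?_, ?_⟩, ?_, ?_, ?_, ?_⟩
    · simp only [hp]
      split_ifs <;> linarith
    · rw [hsum (fun x => x) rfl]
      ring
    · simp only [hq]
      split_ifs
      · linarith
      · positivity
    · simp only [hq, sum_ite_zero_eq]
      field_simp
      ring
    · rw [hHp, min_eq_right (by linarith)]
      gcongr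
      refine Real.binEntropy_strictMonoOn ⟨hε0.le, ?_⟩ ⟨hδ0.le, ?_⟩ hδ1 <;> norm_num <;> linarith
    · rw [hHp]
      have := hbin δ
      nlinarith
    · simpa [hp] using hδ3
    · simpa [hq] using hδ3
  -- Here `4 ε ≥ 2`, so closeness to a point mass is vacuous and only entropies matter. Any value
  -- strictly between `h(min 1 ε)` and `1 / ε = log n / γ ^ 2` serves for `p`, and `log n` for `q`.
  · have hlt : Real.binEntropy (min 1 ε) / Real.log 2 < 1 / ε := by
      rcases lt_or_ge ε 1 with h1 | h1
      · exact (hbin _).trans_lt (by rw [lt_div_iff₀ hε0]; linarith)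
      · rw [min_eq_left h1, Real.binEntropy_one, zero_div]
        positivity
    have hnonneg : 0 ≤ Real.binEntropy (min 1 ε) / Real.log 2 :=
      div_nonneg (Real.binEntropy_nonneg (le_min zero_le_one hε0.le) (min_le_left _ _)) hlog2.le
    obtain ⟨b, hb1, hb2⟩ := exists_between hlt
    have hbL : γ ^ 2 * b < L := by
      rw [lt_div_iff₀ hε0] at hb2
      rw [← hεL]
      nlinarith
    have hb0 : 0 ≤ b := hnonneg.trans hb1.le
    obtain ⟨p, hp, hpb⟩ := exists_shannonEntropy_eq (n := n) (b := b) hb0 (by nlinarith)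
    obtain ⟨q, hq, hqb⟩ := exists_shannonEntropy_eq (n := n) (b := L) hL.le le_rfl
    refine ⟨p, hp, q, hq, by rwa [hpb], by rwa [hpb, hqb], ?_, ?_⟩
    · linarith [hp.1 0]
    · linarith [hq.1 0]

theorem promise_of_lt {γ : ℝ} (hγ : 1 < γ) {p q : Fin n → ℝ}
    (h : shannonEntropy ![1 - min 1 (γ ^ 2 / Real.logb 2 n), min 1 (γ ^ 2 / Real.logb 2 n)]
        < shannonEntropy p) (hpq : γ ^ 2 * shannonEntropy p < shannonEntropy q) :
    Promise γ p ∧ Promise γ q := by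
  have h0 : 0 ≤ shannonEntropy
      ![1 - min 1 (γ ^ 2 / Real.logb 2 n), min 1 (γ ^ 2 / Real.logb 2 n)] := by
    rw [shannonEntropy_two_point]
    have : 0 ≤ Real.logb 2 n := by
      rcases Nat.eq_zero_or_pos n with rfl | hn
      · simp
      · exact Real.logb_nonneg (by norm_num) (by exact_mod_cast hn)
    exact div_nonneg (Real.binEntropy_nonneg (by positivity) (min_le_left _ _))
      (Real.log_nonneg (by norm_num))
  have hp : 0 < shannonEntropy p := h0.trans_lt h
  have hγ2 : 1 < γ ^ 2 := by nlinarith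
  have hlt : shannonEntropy p < shannonEntropy q := by nlinarith
  exact ⟨⟨hp, h.le⟩, hp.trans hlt, (h.trans hlt).le⟩

end entropy

/-! ### Approximation of distributions by frequencies of long strings. -/

section density

variable {n : ℕ}

theorem exists_card_fiber_eq {m : ℕ} {c : Fin n → ℕ} (hc : ∑ i, c i = m) :
    ∃ v : Fin m → Fin n, ∀ i, #{j | v j = i} = c i := by
  classical
  let e : Fin m ≃ Σ i, Fin (c i) := Fintype.equivOfCardEq (by simp [hc])
  refine ⟨fun j => (e j).1, fun i => ?_⟩
  rw [card_equiv (t := (univ : Finset (Fin (c i))).map (Function.Embedding.sigmaMk i)) e]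
  · simp
  · intro j
    simp only [mem_filter_univ, Finset.mem_map, mem_univ, true_and, Function.Embedding.sigmaMk_apply]
    constructor
    · rintro rfl
      exact ⟨_, rfl⟩
    · rintro ⟨a, ha⟩
      rw [← ha]

/-- Every distribution is a limit of frequencies of strings of increasing length. -/
theorem exists_tendsto_frequency [NeZero n] {p : Fin n → ℝ} (hp : p ∈ stdSimplex ℝ (Fin n)) :
    ∃ v : ∀ m : ℕ, Fin m → Fin n, Tendsto (fun m => frequency (v m)) atTop (𝓝 p) := by
  have hle : ∀ m : ℕ, ∑ i ∈ univ.erase 0, ⌊p i * m⌋₊ ≤ m := by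
    intro m
    have h : (∑ i ∈ univ.erase 0, ⌊p i * m⌋₊ : ℝ) ≤ m := by
      calc (∑ i ∈ univ.erase 0, ⌊p i * m⌋₊ : ℝ)
          ≤ ∑ i ∈ univ.erase 0, p i * m := sum_le_sum fun i _ =>
            Nat.floor_le (mul_nonneg (hp.1 i) (Nat.cast_nonneg m))
        _ ≤ ∑ i, p i * m := sum_le_sum_of_subset_of_nonneg (erase_subset _ _) fun i _ _ =>
            mul_nonneg (hp.1 i) (Nat.cast_nonneg m)
        _ = m := by rw [← sum_mul, hp.2, one_mul]
    exact_mod_cast h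
  -- Counts are rounded down at nonzero letters, and the letter 0 absorbs the deficit so that they
  -- sum to `m`.
  let c : ℕ → Fin n → ℕ := fun m i =>
    if i = 0 then m - ∑ i ∈ univ.erase 0, ⌊p i * m⌋₊ else ⌊p i * m⌋₊
  have hc : ∀ m, ∑ i, c m i = m := by
    intro m
    rw [← add_sum_erase univ _ (mem_univ 0)]
    have h : ∑ i ∈ univ.erase 0, c m i = ∑ i ∈ univ.erase 0, ⌊p i * m⌋₊ :=
      sum_congr rfl fun i hi => if_neg (ne_of_mem_erase hi)
    rw [h]
    simp only [c, if_true]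
    exact Nat.sub_add_cancel (hle m)
  choose v hv using fun m => exists_card_fiber_eq (hc m)
  have hne : ∀ i ≠ 0, Tendsto (fun m => frequency (v m) i) atTop (𝓝 (p i)) := by
    intro i hi
    have h := (tendsto_nat_floor_mul_div_atTop (R := ℝ) (hp.1 i)).comp
      (tendsto_natCast_atTop_atTop (R := ℝ))
    refine h.congr fun m => ?_
    simp [frequency, hv, c, hi]
  refine ⟨v, tendsto_pi_nhds.2 fun i => ?_⟩
  rcases ne_or_eq i 0 with hi | rfl
  · exact hne i hi
  · have h1 : p 0 = 1 - ∑ i ∈ univ.erase 0, p i := by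
      rw [← hp.2, ← add_sum_erase univ p (mem_univ 0), add_sub_cancel_right]
    rw [h1]
    refine (tendsto_const_nhds.sub
      (tendsto_finsetSum _ fun i hi => hne i (ne_of_mem_erase hi))).congr' ?_
    filter_upwards [eventually_ne_atTop 0] with m hm
    have : NeZero m := ⟨hm⟩
    rw [← (frequency_mem_stdSimplex (v m)).2, ← add_sum_erase univ _ (mem_univ 0),
      add_sub_cancel_right]

/-- A hard pair of distributions, both of them frequencies of strings of a given large length. -/
theorem eventually_exists_hard_strings [NeZero n] (hn : 2 ≤ n) {γ : ℝ} (hγ : 1 < γ) :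
    ∀ᶠ m : ℕ in atTop, ∃ v w : Fin m → Fin n,
      (Promise γ (frequency v) ∧ Promise γ (frequency w)) ∧
      γ ^ 2 * shannonEntropy (frequency v) < shannonEntropy (frequency w) ∧
      1 - frequency v 0 ≤ 4 * (γ ^ 2 / Real.logb 2 n) ∧
      1 - frequency w 0 ≤ 4 * (γ ^ 2 / Real.logb 2 n) := by
  obtain ⟨p, hp, q, hq, h1, h2, h3, h4⟩ := exists_hard_pair hn hγ
  obtain ⟨v, hv⟩ := exists_tendsto_frequency hp
  obtain ⟨w, hw⟩ := exists_tendsto_frequency hq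
  have hHv := (continuous_shannonEntropy.tendsto p).comp hv
  have hHw := (continuous_shannonEntropy.tendsto q).comp hw
  -- The four inequalities of the hard pair are strict, hence persist for frequencies close enough
  -- to the limits.
  filter_upwards [hHv.eventually (lt_mem_nhds h1),
    (hHv.const_mul (γ ^ 2)).eventually_lt hHw h2,
    (tendsto_const_nhds.sub (tendsto_pi_nhds.1 hv 0)).eventually (gt_mem_nhds h3),
    (tendsto_const_nhds.sub (tendsto_pi_nhds.1 hw 0)).eventually (gt_mem_nhds h4)]
    with m k1 k2 k3 k4
  exact ⟨v m, w m, promise_of_lt hγ k1 k2, k2, k3.le, k4.le⟩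

end density

/-! ### The constant and the four models. -/

theorem mul_sqrt_div_le_of_two_mul_le {s L γ T D : ℝ} (hL : 0 < L) (hγ : 1 < γ)
    (hD : D = 16 * (4 * (γ ^ 2 / L))) (h : 2 * s ≤ 1 + 4 * (T * √D)) :
    (2 * s - 1) / 32 * (√L / γ) ≤ T := by
  have h0 : 0 < γ := by linarith
  have hsL : 0 < √L := Real.sqrt_pos.2 hL
  have h1 : √D = 8 * (γ / √L) := by
    rw [hD, show 16 * (4 * (γ ^ 2 / L)) = (8 * (γ / √L)) ^ 2 by
      rw [mul_pow, div_pow, Real.sq_sqrt hL.le]; ring]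
    exact Real.sqrt_sq (by positivity)
  rw [h1] at h
  calc (2 * s - 1) / 32 * (√L / γ) ≤ (4 * (T * (8 * (γ / √L)))) / 32 * (√L / γ) := by
        gcongr
        linarith
    _ = T := by field_simp; ring

theorem mainTheorem6 (s : ℝ) (hs : 1 / 2 < s) :
    ∃ c : ℝ, 0 < c ∧ ∀ (n : ℕ) [NeZero n] (γ : ℝ), 1 < γ →
      (∃ m₀ : ℕ, ∀ m : ℕ, m₀ ≤ m → ∀ A : QueryAlgorithm (Fin m × Fin n),
        EstimatesFromFrequencyVector A γ s → c * (√(Real.logb 2 n) / γ) ≤ A.queries) ∧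
      (∀ (m : ℕ) (A : QueryAlgorithm (Fin m × Fin n)),
        EstimatesFromSampleList A γ s → c * (√(Real.logb 2 n) / γ) ≤ A.queries) ∧
      (∀ A : QueryAlgorithm (Fin n),
        EstimatesFromQuantumSamples A γ s → c * (√(Real.logb 2 n) / γ) ≤ A.queries) ∧
      (∀ A : QueryAlgorithm (Fin n × Fin n),
        EstimatesFromPurification A γ s → c * (√(Real.logb 2 n) / γ) ≤ A.queries) := by
  refine ⟨(2 * s - 1) / 32, by linarith, fun n _ γ hγ => ?_⟩
  rcases Nat.lt_or_ge n 2 with hn | hn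
  · obtain rfl : n = 1 := by
      have := NeZero.ne n
      omega
    simp
  have hL : 0 < Real.logb 2 n := Real.logb_pos (by norm_num) (by exact_mod_cast hn)
  -- A common bound for all models: the rotations need 16 times the mass off 0, the strings only 4
  -- times.
  set D := 16 * (4 * (γ ^ 2 / Real.logb 2 n)) with hD
  have hD0 : 0 < γ ^ 2 / Real.logb 2 n := by positivity
  obtain ⟨p, hp, q, hq, hpH, hpq, hp0, hq0⟩ := exists_hard_pair hn hγ
  obtain ⟨hpP, hqP⟩ := promise_of_lt hγ hpH hpq
  refine ⟨?_, fun m A hA => ?_, fun A hA => ?_, fun A hA => ?_⟩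
  · obtain ⟨m₀, hm₀⟩ := eventually_atTop.1
      ((eventually_exists_hard_strings hn hγ).and (eventually_ne_atTop 0))
    refine ⟨m₀, fun m hm A hA => ?_⟩
    obtain ⟨⟨v, w, ⟨hv, hw⟩, hvw, hv0, hw0⟩, hm1⟩ := hm₀ m hm
    have : NeZero m := ⟨hm1⟩
    -- The guarantee holds for every shift of `u`, with the same target entropy, and hence on
    -- average over shifts.
    have key : ∀ u : Fin m → Fin n, Promise γ (frequency u) → s ≤ ∑ r : Fin m, (1 / m : ℝ) *
        A.estimateProb (stringOracle (u ∘ Equiv.addRight r)) γ (shannonEntropy (frequency u)) := by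
      intro u hu
      have hm2 : (m : ℝ) ≠ 0 := by exact_mod_cast hm1
      calc s = ∑ r : Fin m, (1 / m : ℝ) * s := by
            simp [hm2]
        _ ≤ _ := by
            gcongr with r
            have h := hA (u ∘ Equiv.addRight r)
            rw [frequency_comp_equiv] at h
            exact h hu
    exact mul_sqrt_div_le_of_two_mul_le hL hγ hD
      (two_mul_le_of_nearIdentity ((nearIdentity_shift v).mono (by linarith))
        ((nearIdentity_shift w).mono (by linarith)) A hγ hvw (key v hv) (key w hw))
  · exact mul_sqrt_div_le_of_two_mul_le hL hγ hD
      (two_mul_le_of_nearIdentity ((nearIdentity_sampleList hp).mono (by linarith))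
        ((nearIdentity_sampleList hq).mono (by linarith)) A hγ hpq (hA p hp hpP) (hA q hq hqP))
  · obtain ⟨U, hU, hUD⟩ := exists_preparesQuantumSample hp
    obtain ⟨V, hV, hVD⟩ := exists_preparesQuantumSample hq
    exact mul_sqrt_div_le_of_two_mul_le hL hγ hD
      (two_mul_le_of_nearIdentity (hUD.mono (by linarith)) (hVD.mono (by linarith)) A hγ hpq
        (by simpa using hA p hp hpP U (hUD.unitary ()) hU)
        (by simpa using hA q hq hqP V (hVD.unitary ()) hV))
  · obtain ⟨U, hU, hUD⟩ := exists_preparesPurification hp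
    obtain ⟨V, hV, hVD⟩ := exists_preparesPurification hq
    exact mul_sqrt_div_le_of_two_mul_le hL hγ hD
      (two_mul_le_of_nearIdentity (hUD.mono (by linarith)) (hVD.mono (by linarith)) A hγ hpq
        (by simpa using hA p hp hpP U (hUD.unitary ()) hU)
        (by simpa using hA q hq hqP V (hVD.unitary ()) hV))
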